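/- Let $G$ be a compact (Hausdorff) topological group with its Borel $\sigma$-algebra and its (regular) Haar probability measure $\mu$, and let $\Phi$ be the $\sigma$-algebra of all Borel sets $A\subseteq G$ with $gAg^{-1}=A$ for every $g\in G$. Let $D>0$ be a real number and suppose that $G$ is $D$-quasi-random, meaning that every continuous complex representation of $G$ of finite dimension less than $D$ is trivial (every $g\in G$ acts as the identity). Then for all Borel measurable functions $f_1,f_2,f_3:G\to\{z\in\mathbb{C}:|z|\le 1\}$, $$\int_G\left|\int_G f_1(x)\,f_2(gx)\,f_3(xg)\,d\mu(x)-\left(\int_G f_1\,d\mu\right)\left(\int_G \mathsf{E}(f_2\mid\Phi)\,\mathsf{E}(f_3\mid\Phi)\,d\mu\right)\right|\,d\mu(g)\le 4D^{-1/8},$$ where $\mathsf{E}(\cdot\mid\Phi)$ denotes conditional expectation with respect to $\mu$; in particular, the outer integrand is $\mu$-integrable as a function of $g$. -/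

import Mathlib

open MeasureTheory

/-- `G` is `D`-quasi-random: every continuous complex representation of `G` of finite
dimension `n < D` is trivial. Every `n`-dimensional complex vector space is isomorphic to
`Fin n → ℂ`, so it is enough to quantify over representations on these spaces. -/
def IsQuasirandom (D : ℝ) (G : Type*) [Group G] [TopologicalSpace G] : Prop :=
  ∀ n : ℕ, (n : ℝ) < D → ∀ ρ : Representation ℂ G (Fin n → ℂ),
    (∀ v, Continuous fun g => ρ g v) → ρ.IsTrivial

/-- The σ-algebra of measurable sets that are invariant under all conjugations
`x ↦ g * x * g⁻¹`. -/
def conjInvariant (G : Type*) [Group G] [m : MeasurableSpace G] : MeasurableSpace G where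
  MeasurableSet' s := MeasurableSet[m] s ∧ ∀ g : G, (fun x => g * x * g⁻¹) ⁻¹' s = s
  measurableSet_empty := ⟨MeasurableSet.empty, fun _ => rfl⟩
  measurableSet_compl s hs :=
    ⟨hs.1.compl, fun g => by rw [Set.preimage_compl, hs.2 g]⟩
  measurableSet_iUnion s hs :=
    ⟨MeasurableSet.iUnion fun i => (hs i).1, fun g => by
      rw [Set.preimage_iUnion]; exact Set.iUnion_congr fun i => (hs i).2 g⟩

theorem conjInvariant_le (G : Type*) [Group G] [m : MeasurableSpace G] :
    conjInvariant G ≤ m := fun _ hs => hs.1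

/-! ### Unitary representations: decay of matrix coefficients off the fixed vectors. -/

section Hilbert

set_option linter.unusedSectionVars false

variable {G : Type*} [Group G] [TopologicalSpace G]
  {H : Type*} [NormedAddCommGroup H] [InnerProductSpace ℂ H]

/-! Quasirandomness enters through one spectral estimate, `IsQuasirandom.integral_norm_inner_sq_le`.
For `v` orthogonal to the fixed vectors, average the rank-one operators of the orbit of `v`. The
result `T` is compact, self-adjoint, commutes with the group and has trace at most `‖v‖ ^ 2`. An
eigenspace for a nonzero eigenvalue is invariant and cannot consist of fixed vectors, so its
dimension is at least `D`; hence `‖T‖ ≤ ‖v‖ ^ 2 / D`. On `L²(G)` this says that right translation,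
left translation and conjugation mix with error `O(1/√D)` in `L²`
(`IsQuasirandom.integral_norm_correlation_sq_le`).

For continuous functions, split `f₁` into its mean and a mean-zero part. The mean leaves the
correlation of `f₂` with the conjugates of `f₃`; conjugation mixing replaces it by the correlation
of the class averages, which are the conditional expectations. For the mean-zero part, pair with a
dual function of `g`, put `y = g * x` and apply Cauchy–Schwarz in `y` to remove `f₂`.
Right-translation mixing decouples the resulting square and leaves autocorrelations of `f₁`, which
are small by left-translation mixing. A second Cauchy–Schwarz makes the bound a fourth power, whence
the exponent `1/8`.

Measurable functions are reached by `L¹` approximation, uniformly in `g`. -/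

theorem Continuous.integrable_of_compactSpace {X E : Type*} [TopologicalSpace X] [CompactSpace X]
    [MeasurableSpace X] [OpensMeasurableSpace X] [NormedAddCommGroup E] {f : X → E}
    (hf : Continuous f) (μ : Measure X) [IsFiniteMeasureOnCompacts μ] : Integrable f μ :=
  hf.integrable_of_hasCompactSupport (HasCompactSupport.of_compactSpace f)

/-- A finite-dimensional subspace of dimension `< D`, invariant under a strongly continuous
isometric representation of a `D`-quasirandom group, consists of fixed vectors. -/
theorem IsQuasirandom.map_eq_self_of_mem {D : ℝ} (hG : IsQuasirandom D G)
    (π : G →* (H →ₗᵢ[ℂ] H)) (hπ : ∀ u, Continuous fun g => π g u) (S : Submodule ℂ H)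
    [FiniteDimensional ℂ S] (hS : ∀ g, ∀ u ∈ S, π g u ∈ S)
    (hD : (Module.finrank ℂ S : ℝ) < D) {u : H} (hu : u ∈ S) (g : G) : π g u = u := by
  let b := (Module.finBasis ℂ S).equivFun
  let r : Representation ℂ G S :=
    { toFun := fun g => (π g).toLinearMap.restrict (hS g)
      map_one' := by ext x; simp
      map_mul' := fun g h => by ext x; simp }
  let ρ : Representation ℂ G (Fin (Module.finrank ℂ S) → ℂ) :=
    { toFun := fun g => b.toLinearMap ∘ₗ r g ∘ₗ b.symm.toLinearMap
      map_one' := by ext x; simp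
      map_mul' := fun g h => by ext x; simp }
  have hρ := hG _ hD ρ (fun v => by
    have h1 : Continuous fun g => r g (b.symm v) :=
      Continuous.subtype_mk (hπ (b.symm v)) _
    exact (LinearMap.continuous_of_finiteDimensional b.toLinearMap).comp h1)
  have h2 : ρ g (b ⟨u, hu⟩) = b ⟨u, hu⟩ := by
    have := hρ.out g
    rw [this]; rfl
  have h3 : b (r g (b.symm (b ⟨u, hu⟩))) = b ⟨u, hu⟩ := h2
  rw [LinearEquiv.symm_apply_apply] at h3
  exact congrArg Subtype.val (b.injective h3)

theorem continuous_rankOne_orbit (π : G →* (H →ₗᵢ[ℂ] H)) (hπ : ∀ u, Continuous fun g => π g u)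
    (v : H) : Continuous fun g => InnerProductSpace.rankOne ℂ (π g v) (π g v) :=
  ((ContinuousLinearMap.smulRightL ℂ H H).continuous₂.comp
    (((innerSL ℂ).continuous.comp (hπ v)).prodMk (hπ v)) :)

variable [IsTopologicalGroup G] [CompactSpace G] [MeasurableSpace G] [BorelSpace G]
  [CompleteSpace H]

/-- The average of the rank one operators `u ↦ ⟪π g v, u⟫ • π g v` over the group. -/
noncomputable def averagedRankOne (μ : Measure G) (π : G →* (H →ₗᵢ[ℂ] H)) (v : H) : H →L[ℂ] H :=
  ∫ g, InnerProductSpace.rankOne ℂ (π g v) (π g v) ∂μ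

variable (μ : Measure G)

theorem averagedRankOne_apply [IsFiniteMeasure μ] (π : G →* (H →ₗᵢ[ℂ] H))
    (hπ : ∀ u, Continuous fun g => π g u) (v u : H) :
    averagedRankOne μ π v u = ∫ g, inner ℂ (π g v) u • π g v ∂μ := by
  rw [averagedRankOne, ContinuousLinearMap.integral_apply
    ((continuous_rankOne_orbit π hπ v).integrable_of_compactSpace μ)]
  rfl

theorem inner_averagedRankOne [IsFiniteMeasure μ] (π : G →* (H →ₗᵢ[ℂ] H))
    (hπ : ∀ u, Continuous fun g => π g u) (v w u : H) :
    inner ℂ w (averagedRankOne μ π v u) = ∫ g, inner ℂ (π g v) u * inner ℂ w (π g v) ∂μ := by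
  rw [averagedRankOne_apply μ π hπ, ← integral_inner]
  · simp [inner_smul_right]
  · exact (((hπ v).inner continuous_const).smul (hπ v)).integrable_of_compactSpace μ

/-- Turns the second moment of a matrix coefficient into a quadratic form, so that bounding the
operator norm suffices. -/
theorem inner_averagedRankOne_self [IsFiniteMeasure μ] (π : G →* (H →ₗᵢ[ℂ] H))
    (hπ : ∀ u, Continuous fun g => π g u) (v u : H) :
    inner ℂ u (averagedRankOne μ π v u) = ((∫ g, ‖inner ℂ (π g v) u‖ ^ 2 ∂μ : ℝ) : ℂ) := by
  rw [inner_averagedRankOne μ π hπ, ← integral_complex_ofReal]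
  congr with g
  rw [← inner_conj_symm u, Complex.mul_conj, Complex.normSq_eq_norm_sq]

theorem isSymmetric_averagedRankOne [IsFiniteMeasure μ] (π : G →* (H →ₗᵢ[ℂ] H))
    (hπ : ∀ u, Continuous fun g => π g u) (v : H) :
    (averagedRankOne μ π v : H →ₗ[ℂ] H).IsSymmetric := by
  intro x y
  rw [ContinuousLinearMap.coe_coe, ← inner_conj_symm, inner_averagedRankOne μ π hπ,
    inner_averagedRankOne μ π hπ, ← integral_conj]
  congr with g
  rw [map_mul, inner_conj_symm, inner_conj_symm, mul_comm]

/-- Compact operators form a closed convex set containing the rank-one operators, so a probability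
average stays inside it. -/
theorem isCompactOperator_averagedRankOne [IsProbabilityMeasure μ] (π : G →* (H →ₗᵢ[ℂ] H))
    (hπ : ∀ u, Continuous fun g => π g u) (v : H) :
    IsCompactOperator (averagedRankOne μ π v) := by
  have hc := ((compactOperator (RingHom.id ℂ) H H).restrictScalars ℝ).convex
  refine hc.integral_mem isClosed_setOfPred_isCompactOperator (.of_forall fun g => ?_)
    ((continuous_rankOne_orbit π hπ v).integrable_of_compactSpace μ)
  exact (isCompactOperator_of_locallyCompactSpace_rng
    (ContinuousLinearMap.toSpanSingleton ℂ (π g v))).comp_clm (innerSL ℂ (π g v))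

theorem averagedRankOne_map [IsFiniteMeasure μ] [μ.IsMulLeftInvariant] (π : G →* (H →ₗᵢ[ℂ] H))
    (hπ : ∀ u, Continuous fun g => π g u) (v u : H) (h : G) :
    averagedRankOne μ π v (π h u) = π h (averagedRankOne μ π v u) := by
  rw [averagedRankOne_apply μ π hπ, averagedRankOne_apply μ π hπ,
    ← integral_mul_left_eq_self _ h]
  have : ∫ g, π h (inner ℂ (π g v) u • π g v) ∂μ = π h (∫ g, inner ℂ (π g v) u • π g v ∂μ) :=
    (π h).toContinuousLinearMap.integral_comp_comm
      ((((hπ v).inner continuous_const).smul (hπ v)).integrable_of_compactSpace μ)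
  rw [← this]
  congr with g
  simp

/-- Matrix coefficients of a unitary representation of a `D`-quasirandom compact group are small
in `L²` off the fixed vectors. -/
theorem IsQuasirandom.integral_norm_inner_sq_le {D : ℝ} (hG : IsQuasirandom D G)
    [IsProbabilityMeasure μ] [μ.IsMulLeftInvariant] (hD : 0 < D)
    (π : G →* (H →ₗᵢ[ℂ] H)) (hπ : ∀ u, Continuous fun g => π g u) (v : H)
    (hv : ∀ w, (∀ g, π g w = w) → inner ℂ w v = 0) (u : H) :
    ∫ g, ‖inner ℂ (π g v) u‖ ^ 2 ∂μ ≤ ‖v‖ ^ 2 * ‖u‖ ^ 2 / D := by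
  set T := averagedRankOne μ π v with hT
  have hsymm := isSymmetric_averagedRankOne μ π hπ v
  have hcpt := isCompactOperator_averagedRankOne μ π hπ v
  suffices hnorm : ‖T‖ ≤ ‖v‖ ^ 2 / D by
    have h1 : ∫ g, ‖inner ℂ (π g v) u‖ ^ 2 ∂μ ≤ ‖inner ℂ u (T u)‖ := by
      rw [hT, inner_averagedRankOne_self μ π hπ, Complex.norm_real]
      exact le_abs_self _
    calc _ ≤ ‖inner ℂ u (T u)‖ := h1
      _ ≤ ‖u‖ * (‖T‖ * ‖u‖) := (norm_inner_le_norm _ _).trans (by gcongr; exact T.le_opNorm u)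
      _ ≤ ‖u‖ * (‖v‖ ^ 2 / D * ‖u‖) := by gcongr
      _ = _ := by ring
  by_cases hT0 : T = 0
  · rw [hT0, norm_zero]; positivity
  have : Nontrivial H := by
    by_contra hn
    rw [not_nontrivial_iff_subsingleton] at hn
    exact hT0 (Subsingleton.elim _ _)
  -- Self-adjointness makes the spectral radius equal to the norm, so the norm is attained at a
  -- spectral value; compactness makes this value an eigenvalue.
  obtain ⟨l, hl, hlT⟩ := spectrum.exists_nnnorm_eq_spectralRadius T
  rw [T.spectralRadius_eq_nnnorm hsymm.isSelfAdjoint, ENNReal.coe_inj] at hlT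
  have hlT : ‖l‖ = ‖T‖ := congrArg NNReal.toReal hlT
  have hl0 : l ≠ 0 := by
    rw [← norm_ne_zero_iff, hlT]; simpa using hT0
  rw [← hcpt.hasEigenvalue_iff_mem_spectrum hl0] at hl
  set S := Module.End.eigenspace (T : H →ₗ[ℂ] H) l with hSdef
  have hfin : FiniteDimensional ℂ S := T.finite_dimensional_eigenspace hcpt l hl0
  have hSmem : ∀ x, x ∈ S ↔ T x = l • x := fun x => Module.End.mem_eigenspace_iff
  have hSinv : ∀ g, ∀ x ∈ S, π g x ∈ S := by
    intro g x hx
    rw [hSmem] at hx ⊢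
    rw [hT, averagedRankOne_map μ π hπ, ← hT, hx, map_smul]
  -- In smaller dimension the eigenvectors would be fixed, hence orthogonal to the whole orbit of
  -- `v` and killed by `T`, although `l ≠ 0`.
  have hdim : D ≤ Module.finrank ℂ S := by
    by_contra hlt
    push Not at hlt
    obtain ⟨x, hx, hx0⟩ := hl.exists_hasEigenvector
    have hfix := hG.map_eq_self_of_mem π hπ S hSinv hlt hx
    have hxv : ∀ g, inner ℂ (π g v) x = 0 := fun g => by
      have h1 : inner ℂ (π g v) (π g x) = 0 := by
        rw [LinearIsometry.inner_map_map, ← inner_conj_symm, hv x hfix, map_zero]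
      rwa [hfix g] at h1
    have : l • x = 0 := by
      rw [← (hSmem x).1 hx, hT, averagedRankOne_apply μ π hπ]
      simp [hxv]
    simp_all
  let e := stdOrthonormalBasis ℂ S
  have he : Orthonormal ℂ (fun i => (e i : H)) :=
    e.orthonormal.comp_linearIsometry S.subtypeₗᵢ
  -- The left side is the absolute trace of `T` on `S`; Bessel's inequality bounds it.
  have hsum : (Module.finrank ℂ S : ℝ) * ‖l‖ ≤ ‖v‖ ^ 2 := by
    calc (Module.finrank ℂ S : ℝ) * ‖l‖
        = ∑ i : Fin (Module.finrank ℂ S), ‖inner ℂ (e i : H) (T (e i))‖ := by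
          have : ∀ i, ‖inner ℂ (e i : H) (T (e i))‖ = ‖l‖ := fun i => by
            rw [(hSmem _).1 (e i).2, inner_smul_right, inner_self_eq_norm_sq_to_K, he.1 i]
            simp
          simp [this]
      _ = ∑ i, ∫ g, ‖inner ℂ (π g v) (e i : H)‖ ^ 2 ∂μ := by
          congr with i
          rw [hT, inner_averagedRankOne_self μ π hπ, Complex.norm_real,
            Real.norm_of_nonneg (integral_nonneg fun g => by positivity)]
      _ = ∫ g, ∑ i, ‖inner ℂ (π g v) (e i : H)‖ ^ 2 ∂μ := by
          rw [integral_finsetSum]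
          exact fun i _ => (((hπ v).inner continuous_const).norm.pow
            2).integrable_of_compactSpace μ
      _ ≤ ∫ g, ‖v‖ ^ 2 ∂μ := by
          refine integral_mono_of_nonneg (.of_forall fun g => by positivity)
            (integrable_const _) (.of_forall fun g => ?_)
          have := he.sum_inner_products_le (x := π g v) (s := Finset.univ)
          simpa [norm_inner_symm] using this
      _ = ‖v‖ ^ 2 := by simp
  rw [le_div_iff₀ hD, ← hlT, mul_comm]
  exact (mul_le_mul_of_nonneg_right hdim (norm_nonneg _)).trans hsum

end Hilbert

/-! ### Integrals of continuous functions on compact spaces. -/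

section ContinuousFunctions

theorem norm_integral_le_of_forall_norm_le {X E : Type*} [MeasurableSpace X] {μ : Measure X}
    [IsProbabilityMeasure μ] [NormedAddCommGroup E] [NormedSpace ℝ E] {f : X → E} {C : ℝ}
    (hf : ∀ x, ‖f x‖ ≤ C) : ‖∫ x, f x ∂μ‖ ≤ C := by
  simpa using norm_integral_le_of_norm_le_const (μ := μ) (.of_forall hf)

variable {X Y : Type*} [TopologicalSpace X] [CompactSpace X] [MeasurableSpace X]
  [OpensMeasurableSpace X] [TopologicalSpace Y]

theorem Continuous.integral_of_compactSpace {μ : Measure X}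
    [IsFiniteMeasureOnCompacts μ] {F : Y → X → ℂ} (hF : Continuous fun p : Y × X => F p.1 p.2) :
    Continuous fun y => ∫ x, F y x ∂μ := by
  rw [← continuousOn_univ]
  exact continuousOn_integral_of_compact_support (k := Set.univ) isCompact_univ
    (f := F) hF.continuousOn (fun _ _ _ h => absurd (Set.mem_univ _) h)

theorem Continuous.integral_integral_swap [CompactSpace Y] [MeasurableSpace Y]
    [OpensMeasurableSpace Y] {μ : Measure X} {ν : Measure Y} [IsFiniteMeasureOnCompacts μ]
    [IsFiniteMeasureOnCompacts ν] {F : X → Y → ℂ} (hF : Continuous fun p : X × Y => F p.1 p.2) :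
    ∫ x, ∫ y, F x y ∂ν ∂μ = ∫ y, ∫ x, F x y ∂μ ∂ν :=
  integral_integral_swap_of_hasCompactSupport (f := F) hF (HasCompactSupport.of_compactSpace _)

theorem Continuous.sq_integral_norm_le {μ : Measure X} [IsProbabilityMeasure μ] {f : X → ℂ}
    (hf : Continuous f) : (∫ x, ‖f x‖ ∂μ) ^ 2 ≤ ∫ x, ‖f x‖ ^ 2 ∂μ := by
  set c := ∫ x, ‖f x‖ ∂μ with hc
  have h1 : Integrable (fun x => ‖f x‖ ^ 2) μ := (hf.norm.pow 2).integrable_of_compactSpace μ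
  have h2 : Integrable (fun x => 2 * c * ‖f x‖) μ :=
    (continuous_const.mul hf.norm).integrable_of_compactSpace μ
  have h3 : 0 ≤ ∫ x, (‖f x‖ ^ 2 - 2 * c * ‖f x‖ + c ^ 2) ∂μ :=
    integral_nonneg fun x => by simp only [Pi.zero_apply]; nlinarith [sq_nonneg (‖f x‖ - c)]
  have h12 : Integrable (fun x => ‖f x‖ ^ 2 - 2 * c * ‖f x‖) μ := h1.sub h2
  rw [integral_add h12 (integrable_const _), integral_sub h1 h2, integral_const_mul,
    ← hc] at h3
  simp at h3
  nlinarith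

theorem Continuous.sq_norm_integral_mul_le {μ : Measure X} [IsProbabilityMeasure μ] {f g : X → ℂ}
    (hf : Continuous f) (hg : Continuous g) (hb : ∀ x, ‖g x‖ ≤ 1) :
    ‖∫ x, g x * f x ∂μ‖ ^ 2 ≤ ∫ x, ‖f x‖ ^ 2 ∂μ := by
  refine le_trans ?_ hf.sq_integral_norm_le
  gcongr
  refine (norm_integral_le_integral_norm _).trans
    (integral_mono ((hg.mul hf).norm.integrable_of_compactSpace μ)
      (hf.norm.integrable_of_compactSpace μ) fun x => ?_)
  simpa using mul_le_mul_of_nonneg_right (hb x) (norm_nonneg (f x))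

end ContinuousFunctions

/-! ### Mixing for actions of the group on itself. -/

section Koopman

variable {G : Type*} [Group G] [TopologicalSpace G] [IsTopologicalGroup G]
    [CompactSpace G] [T2Space G] [MeasurableSpace G] [BorelSpace G]
    {μ : Measure G} [IsProbabilityMeasure μ] [μ.Regular]

/-- A right translate of the measure is again a Haar probability measure, so uniqueness applies. -/
theorem isMulRightInvariant_of_compactSpace (μ : Measure G) [μ.IsHaarMeasure]
    [IsProbabilityMeasure μ] : μ.IsMulRightInvariant where
  map_mul_right_eq_self g := by
    have : IsProbabilityMeasure (μ.map (· * g)) :=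
      Measure.isProbabilityMeasure_map (by fun_prop)
    exact Measure.isHaarMeasure_eq_of_isProbabilityMeasure _ _

/-- If a continuous function has vanishing averages along the orbits of a continuous
measure-preserving (right) action of a `D`-quasirandom compact group on itself, then its
correlations under the action are small in `L²`. -/
theorem IsQuasirandom.integral_norm_correlation_sq_le {D : ℝ} (hG : IsQuasirandom D G)
    [μ.IsMulLeftInvariant] (hD : 0 < D) {b : G → G → G}
    (hb : Continuous fun p : G × G => b p.1 p.2) (hone : ∀ x, b 1 x = x)
    (hmul : ∀ g h x, b (g * h) x = b h (b g x)) (hmp : ∀ g, MeasurePreserving (b g) μ μ)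
    {u v : G → ℂ} (hu : Continuous u) (hv : Continuous v) {A B : ℝ} (hA : ∀ x, ‖u x‖ ≤ A)
    (hB : ∀ x, ‖v x‖ ≤ B) (hvb : ∀ x, ∫ g, v (b g x) ∂μ = 0) :
    ∫ g, ‖∫ x, u x * v (b g x) ∂μ‖ ^ 2 ∂μ ≤ A ^ 2 * B ^ 2 / D := by
  -- Composition reverses order, so the reversed law `hmul` is what makes this a homomorphism.
  let π : G →* (Lp ℂ 2 μ →ₗᵢ[ℂ] Lp ℂ 2 μ) :=
    { toFun := fun g => Lp.compMeasurePreservingₗᵢ ℂ (b g) (hmp g)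
      map_one' := by
        ext1 w
        refine Lp.ext ((Lp.coeFn_compMeasurePreserving w (hmp 1)).trans ?_)
        simp [Function.comp_def, hone]
      map_mul' := fun g h => by
        ext1 w
        have h1 := Lp.coeFn_compMeasurePreserving w (hmp (g * h))
        have h2 := Lp.coeFn_compMeasurePreserving (Lp.compMeasurePreserving (b h) (hmp h) w) (hmp g)
        have h3 := (hmp g).quasiMeasurePreserving.ae_eq_comp
          (Lp.coeFn_compMeasurePreserving w (hmp h))
        refine Lp.ext (h1.trans ((h2.trans h3).trans (.of_forall fun x => ?_)).symm)
        simp [hmul] }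
  have hπ : ∀ w, Continuous fun g => π g w := fun w =>
    continuous_const.compMeasurePreservingLp (ContinuousMap.curry ⟨_, hb⟩).continuous hmp (by simp)
  let c : ∀ f : G → ℂ, Continuous f → Lp ℂ 2 μ := fun f hf => ContinuousMap.toLp 2 μ ℂ ⟨f, hf⟩
  have hc : ∀ f (hf : Continuous f), c f hf =ᵐ[μ] f := fun f hf => ContinuousMap.coeFn_toLp _ _
  have hcn : ∀ f (hf : Continuous f) C, (∀ x, ‖f x‖ ≤ C) → ‖c f hf‖ ≤ C := by
    intro f hf C hC
    have := Lp.norm_le_of_ae_bound (f := c f hf) ((norm_nonneg _).trans (hC 1))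
      ((hc f hf).mono fun x hx => by rw [hx]; exact hC x)
    simpa [measureUnivNNReal] using this
  have hbg : ∀ g, Continuous (b g) := fun g => hb.comp (Continuous.prodMk_right g)
  have hπc : ∀ g, π g (c v hv) = c (v ∘ b g) (hv.comp (hbg g)) := fun g =>
    Lp.ext (((Lp.coeFn_compMeasurePreserving _ (hmp g)).trans
      ((hmp g).quasiMeasurePreserving.ae_eq_comp (hc v hv))).trans (hc _ _).symm)
  -- The orbit average is computed in `C(G, ℂ)`, where it can be evaluated pointwise, and then
  -- mapped to `L²`.
  have hzero : ∫ g, π g (c v hv) ∂μ = 0 := by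
    let F : G → C(G, ℂ) := ContinuousMap.curry ⟨fun p : G × G => v (b p.1 p.2), hv.comp hb⟩
    have hF : Integrable F μ := (ContinuousMap.curry _).continuous.integrable_of_compactSpace μ
    have h1 : ∀ g, π g (c v hv) = ContinuousMap.toLp 2 μ ℂ (F g) := hπc
    have h2 : ∫ g, F g ∂μ = 0 := by
      ext x
      rw [ContinuousMap.integral_apply hF]
      exact hvb x
    simp_rw [h1]
    rw [ContinuousLinearMap.integral_comp_comm _ hF, h2, map_zero]
  have horth : ∀ w, (∀ g, π g w = w) → inner ℂ w (c v hv) = 0 := by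
    intro w hw
    have h1 : ∀ g, inner ℂ w (π g (c v hv)) = inner ℂ w (c v hv) := fun g => by
      conv_lhs => rw [← hw g]
      exact (π g).inner_map_map _ _
    have h2 := integral_inner (𝕜 := ℂ) ((hπ (c v hv)).integrable_of_compactSpace μ) w
    rw [hzero, inner_zero_right] at h2
    simpa [h1] using h2
  have hcu : Continuous fun x => (starRingEnd ℂ) (u x) := Complex.continuous_conj.comp hu
  have key := hG.integral_norm_inner_sq_le μ hD π hπ (c v hv) horth (c _ hcu)
  calc _ = ∫ g, ‖inner ℂ (π g (c v hv)) (c _ hcu)‖ ^ 2 ∂μ := by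
        congr with g
        rw [norm_inner_symm, hπc, ContinuousMap.inner_toLp]
        simp [mul_comm]
    _ ≤ _ := key
    _ ≤ B ^ 2 * A ^ 2 / D := by
        have := hcn _ hcu A (fun x => by simpa using hA x)
        have := hcn _ hv B hB
        gcongr
    _ = _ := by ring

end Koopman

/-! ### Triple correlations and conjugacy averages of continuous functions. -/

section Correlations

set_option linter.unusedSectionVars false

open scoped ComplexConjugate

variable {G : Type*} [Group G] [TopologicalSpace G] [IsTopologicalGroup G]
    [CompactSpace G] [MeasurableSpace G] [BorelSpace G]
    {μ : Measure G} [IsProbabilityMeasure μ]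

/-- The left side is independent of `x` by left invariance in `k`; averaging over `x` and swapping
the integrals gives its value. -/
theorem Continuous.integral_inv_mul_eq [μ.IsMulLeftInvariant] [μ.IsMulRightInvariant] {f : G → ℂ}
    (hf : Continuous f) (x : G) : ∫ k, f (k⁻¹ * x) ∂μ = ∫ k, f k ∂μ := by
  have h1 : ∀ y, ∫ k, f (k⁻¹ * y) ∂μ = ∫ k, f (k⁻¹ * x) ∂μ := fun y => by
    rw [← integral_mul_left_eq_self _ (y * x⁻¹)]
    simp [mul_assoc]
  have h2 : Continuous fun p : G × G => f (p.2⁻¹ * p.1) := by fun_prop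
  have h3 := h2.integral_integral_swap (F := fun y k => f (k⁻¹ * y)) (μ := μ) (ν := μ)
  simp_rw [h1, integral_mul_left_eq_self f] at h3
  simpa using h3

variable [T2Space G] [μ.Regular] [μ.IsMulLeftInvariant] [μ.IsMulRightInvariant]
  {D : ℝ}

/-- In a quasirandom group the triples `(g, x, x * g)` are nearly independent. -/
theorem IsQuasirandom.norm_integral_mul_convolution_le (hG : IsQuasirandom D G) (hD : 0 < D)
    {ψ a b : G → ℂ} (hψ : Continuous ψ) (ha : Continuous a) (hb : Continuous b)
    (hψ1 : ∀ x, ‖ψ x‖ ≤ 1) (ha1 : ∀ x, ‖a x‖ ≤ 1) (hb1 : ∀ x, ‖b x‖ ≤ 1) :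
    ‖∫ g, ψ g * ∫ x, a x * b (x * g) ∂μ ∂μ‖ ≤ ‖∫ x, a x ∂μ‖ + 2 / √D := by
  set m := ∫ x, b x ∂μ with hm
  have hm1 : ‖m‖ ≤ 1 := norm_integral_le_of_forall_norm_le hb1
  set R : G → ℂ := fun g => ∫ x, a x * (b (x * g) - m) ∂μ with hR
  have hRc : Continuous R := Continuous.integral_of_compactSpace (by fun_prop)
  have hsplit : ∀ g, ∫ x, a x * b (x * g) ∂μ = (∫ x, a x ∂μ) * m + R g := fun g => by
    have h1 : Integrable (fun x => a x * m) μ :=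
      Continuous.integrable_of_compactSpace (by fun_prop) μ
    have h2 : Integrable (fun x => a x * (b (x * g) - m)) μ :=
      Continuous.integrable_of_compactSpace (by fun_prop) μ
    rw [hR, ← integral_mul_const, ← integral_add h1 h2]
    congr with x
    ring
  -- Right-translation mixing for `b - m`, whose orbit averages vanish; the factor `2 ^ 2` is its
  -- squared sup bound.
  have hbound : ∫ g, ‖R g‖ ^ 2 ∂μ ≤ 1 ^ 2 * 2 ^ 2 / D :=
    hG.integral_norm_correlation_sq_le hD (b := fun g x => x * g) (v := fun x => b x - m)
      (by fun_prop) (by simp) (by simp [mul_assoc]) (measurePreserving_mul_right μ) ha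
      (by fun_prop) ha1 (fun x => (norm_sub_le _ _).trans (by linarith [hb1 x]))
      (fun x => by
        have h1 : Integrable (fun g => b (x * g)) μ :=
          Continuous.integrable_of_compactSpace (by fun_prop) μ
        rw [integral_sub h1 (integrable_const _), integral_mul_left_eq_self b x]
        simp [hm])
  have hψR : ‖∫ g, ψ g * R g ∂μ‖ ≤ 2 / √D := by
    refine abs_le_of_sq_le_sq' ?_ (by positivity) |>.2
    refine ((hRc.sq_norm_integral_mul_le hψ hψ1).trans hbound).trans (le_of_eq ?_)
    rw [div_pow, Real.sq_sqrt hD.le]; norm_num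
  have h1 : Integrable (fun g => ψ g * ((∫ x, a x ∂μ) * m)) μ :=
    Continuous.integrable_of_compactSpace (by fun_prop) μ
  have h2 : Integrable (fun g => ψ g * R g) μ :=
    Continuous.integrable_of_compactSpace (by fun_prop) μ
  have h3 : ∫ g, ψ g * ∫ x, a x * b (x * g) ∂μ ∂μ =
      (∫ g, ψ g ∂μ) * ((∫ x, a x ∂μ) * m) + ∫ g, ψ g * R g ∂μ := by
    rw [← integral_mul_const, ← integral_add h1 h2]
    congr with g
    rw [hsplit]; ring
  rw [h3]
  refine (norm_add_le _ _).trans (add_le_add ?_ hψR)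
  have hψm : ‖∫ g, ψ g ∂μ‖ ≤ 1 := norm_integral_le_of_forall_norm_le hψ1
  rw [norm_mul, norm_mul]
  calc _ ≤ 1 * (‖∫ x, a x ∂μ‖ * 1) := by gcongr
    _ = _ := by ring

theorem IsQuasirandom.integral_norm_autocorrelation_le (hG : IsQuasirandom D G) (hD : 0 < D)
    {f : G → ℂ} (hf : Continuous f) (hf1 : ∀ x, ‖f x‖ ≤ 1) (hf0 : ∫ x, f x ∂μ = 0) :
    ∫ k, ‖∫ x, f x * conj (f (k * x)) ∂μ‖ ∂μ ≤ 1 / √D := by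
  have hc : Continuous fun k => ∫ x, f x * conj (f (k * x)) ∂μ :=
    Continuous.integral_of_compactSpace (by fun_prop)
  -- The shift moves to `k⁻¹` because `x ↦ g⁻¹ * x` obeys the reversed composition law.
  have h : ∀ k, ∫ x, f x * conj (f (k * x)) ∂μ = ∫ x, conj (f x) * f (k⁻¹ * x) ∂μ := fun k => by
    rw [← integral_mul_left_eq_self _ k⁻¹]
    simp [mul_comm]
  have hbound : ∫ k, ‖∫ x, f x * conj (f (k * x)) ∂μ‖ ^ 2 ∂μ ≤ 1 ^ 2 * 1 ^ 2 / D := by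
    simp_rw [h]
    exact hG.integral_norm_correlation_sq_le hD (b := fun g x => g⁻¹ * x)
      (by fun_prop) (by simp) (by simp [mul_assoc]) (fun g => measurePreserving_mul_left μ g⁻¹)
      (by fun_prop) hf (by simpa using hf1) hf1 (fun x => by rw [hf.integral_inv_mul_eq, hf0])
  refine abs_le_of_sq_le_sq' ?_ (by positivity) |>.2
  refine (hc.sq_integral_norm_le.trans hbound).trans (le_of_eq ?_)
  rw [div_pow, Real.sq_sqrt hD.le]; norm_num

/-- Cauchy–Schwarz in `y = g * x` discards `f₂`. In the expanded square, right-translation mixing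
costs `2/√D` and the mean autocorrelation of `f₁` costs `1/√D`. -/
theorem IsQuasirandom.sq_norm_integral_triple_le (hG : IsQuasirandom D G) (hD : 0 < D)
    {ψ f₁ f₂ f₃ : G → ℂ} (hψ : Continuous ψ) (h₁ : Continuous f₁) (h₂ : Continuous f₂)
    (h₃ : Continuous f₃) (hψ1 : ∀ x, ‖ψ x‖ ≤ 1) (hb₁ : ∀ x, ‖f₁ x‖ ≤ 1) (hb₂ : ∀ x, ‖f₂ x‖ ≤ 1)
    (hb₃ : ∀ x, ‖f₃ x‖ ≤ 1) (hf₁ : ∫ x, f₁ x ∂μ = 0) :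
    ‖∫ g, ψ g * ∫ x, f₁ x * f₂ (g * x) * f₃ (x * g) ∂μ ∂μ‖ ^ 2 ≤ 3 / √D := by
  -- With `y = g * x` one has `g = y * x⁻¹` and `x * g = x * y * x⁻¹`.
  let W : G → G → ℂ := fun x y => ψ (y * x⁻¹) * f₁ x * f₃ (x * y * x⁻¹)
  have hW : Continuous fun p : G × G => W p.1 p.2 := by fun_prop
  let J : G → ℂ := fun y => ∫ x, W x y ∂μ
  have hJ : Continuous J := Continuous.integral_of_compactSpace (by fun_prop)
  have hstep : ∫ g, ψ g * ∫ x, f₁ x * f₂ (g * x) * f₃ (x * g) ∂μ ∂μ = ∫ y, f₂ y * J y ∂μ := by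
    calc _ = ∫ g, ∫ x, ψ g * (f₁ x * f₂ (g * x) * f₃ (x * g)) ∂μ ∂μ := by
          simp_rw [integral_const_mul]
      _ = ∫ x, ∫ g, ψ g * (f₁ x * f₂ (g * x) * f₃ (x * g)) ∂μ ∂μ :=
          Continuous.integral_integral_swap (by fun_prop)
      _ = ∫ x, ∫ y, f₂ y * W x y ∂μ ∂μ := by
          congr with x
          rw [← integral_mul_right_eq_self _ x⁻¹]
          congr with y
          simp only [W, inv_mul_cancel, mul_one, mul_assoc]
          ring
      _ = ∫ y, ∫ x, f₂ y * W x y ∂μ ∂μ := Continuous.integral_integral_swap (by fun_prop)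
      _ = _ := by simp_rw [integral_const_mul]; rfl
  -- Multiplicative derivatives in direction `k`: writing the second copy of `x` as `k * x` and
  -- returning to `y = g * x`, the square separates into factors in `g`, `x` and `x * g`.
  let Ψ : G → G → ℂ := fun k g => ψ g * conj (ψ (g * k⁻¹))
  let A : G → G → ℂ := fun k x => f₁ x * conj (f₁ (k * x))
  let B : G → G → ℂ := fun k z => f₃ z * conj (f₃ (k * z * k⁻¹))
  have hΨ : Continuous fun p : G × G => Ψ p.1 p.2 := by fun_prop
  have hA : Continuous fun p : G × G => A p.1 p.2 := by fun_prop
  have hB : Continuous fun p : G × G => B p.1 p.2 := by fun_prop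
  have hsq : ((∫ y, ‖J y‖ ^ 2 ∂μ : ℝ) : ℂ) =
      ∫ k, ∫ g, Ψ k g * ∫ x, A k x * B k (x * g) ∂μ ∂μ ∂μ := by
    calc ((∫ y, ‖J y‖ ^ 2 ∂μ : ℝ) : ℂ) = ∫ y, ∫ x, ∫ k, W x y * conj (W (k * x) y) ∂μ ∂μ ∂μ := by
          rw [← integral_complex_ofReal]
          congr with y
          have h1 : ∀ x, ∫ k, W x y * conj (W (k * x) y) ∂μ = W x y * conj (J y) := fun x => by
            rw [integral_const_mul, integral_mul_right_eq_self (fun x => conj (W x y)) x,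
              integral_conj]
          simp_rw [h1]
          rw [integral_mul_const, ← Complex.normSq_eq_norm_sq, ← Complex.mul_conj]
      _ = ∫ x, ∫ y, ∫ k, W x y * conj (W (k * x) y) ∂μ ∂μ ∂μ :=
          Continuous.integral_integral_swap
            (Continuous.integral_of_compactSpace (Y := G × G) (by fun_prop))
      _ = ∫ x, ∫ g, ∫ k, Ψ k g * (A k x * B k (x * g)) ∂μ ∂μ ∂μ := by
          congr with x
          rw [← integral_mul_right_eq_self _ x]
          congr with g
          congr with k
          simp only [W, Ψ, A, B, mul_inv_rev, mul_inv_cancel, mul_inv_cancel_left, mul_one, mul_assoc,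
            map_mul]
          ring
      _ = ∫ x, ∫ k, ∫ g, Ψ k g * (A k x * B k (x * g)) ∂μ ∂μ ∂μ := by
          congr with x
          exact Continuous.integral_integral_swap (by fun_prop)
      _ = ∫ k, ∫ x, ∫ g, Ψ k g * (A k x * B k (x * g)) ∂μ ∂μ ∂μ :=
          Continuous.integral_integral_swap
            (Continuous.integral_of_compactSpace (Y := G × G) (by fun_prop))
      _ = ∫ k, ∫ g, ∫ x, Ψ k g * (A k x * B k (x * g)) ∂μ ∂μ ∂μ := by
          congr with k
          exact Continuous.integral_integral_swap (by fun_prop)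
      _ = _ := by simp_rw [integral_const_mul]
  have hprod : ∀ z w : ℂ, ‖z‖ ≤ 1 → ‖w‖ ≤ 1 → ‖z * conj w‖ ≤ 1 := fun z w hz hw => by
    rw [norm_mul, RCLike.norm_conj]
    exact mul_le_one₀ hz (norm_nonneg _) hw
  have hAint : Continuous fun k => ∫ x, A k x ∂μ := Continuous.integral_of_compactSpace hA
  calc _ ≤ ∫ y, ‖J y‖ ^ 2 ∂μ := by
        rw [hstep]
        exact hJ.sq_norm_integral_mul_le h₂ hb₂
    _ = ‖((∫ y, ‖J y‖ ^ 2 ∂μ : ℝ) : ℂ)‖ := by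
        rw [Complex.norm_real, Real.norm_of_nonneg (integral_nonneg fun y => by positivity)]
    _ ≤ ∫ k, ‖∫ g, Ψ k g * ∫ x, A k x * B k (x * g) ∂μ ∂μ‖ ∂μ := by
        rw [hsq]; exact norm_integral_le_integral_norm _
    _ ≤ ∫ k, (‖∫ x, A k x ∂μ‖ + 2 / √D) ∂μ := by
        refine integral_mono_of_nonneg (.of_forall fun k => norm_nonneg _)
          (Continuous.integrable_of_compactSpace (by fun_prop) μ) (.of_forall fun k => ?_)
        exact hG.norm_integral_mul_convolution_le hD (by fun_prop) (by fun_prop) (by fun_prop)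
          (fun g => hprod _ _ (hψ1 _) (hψ1 _)) (fun x => hprod _ _ (hb₁ _) (hb₁ _))
          (fun z => hprod _ _ (hb₃ _) (hb₃ _))
    _ = ∫ k, ‖∫ x, A k x ∂μ‖ ∂μ + 2 / √D := by
        rw [integral_add (hAint.norm.integrable_of_compactSpace μ) (integrable_const _)]
        simp
    _ ≤ 1 / √D + 2 / √D := by
        gcongr
        exact hG.integral_norm_autocorrelation_le hD h₁ hb₁ hf₁
    _ = 3 / √D := by ring

/-- The averaged triple correlation with a mean zero first function. -/
theorem IsQuasirandom.integral_norm_triple_pow_four_le (hG : IsQuasirandom D G) (hD : 0 < D)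
    {f₁ f₂ f₃ : G → ℂ} (h₁ : Continuous f₁) (h₂ : Continuous f₂)
    (h₃ : Continuous f₃) (hb₁ : ∀ x, ‖f₁ x‖ ≤ 1) (hb₂ : ∀ x, ‖f₂ x‖ ≤ 1)
    (hb₃ : ∀ x, ‖f₃ x‖ ≤ 1) (hf₁ : ∫ x, f₁ x ∂μ = 0) :
    (∫ g, ‖∫ x, f₁ x * f₂ (g * x) * f₃ (x * g) ∂μ‖ ∂μ) ^ 4 ≤ 3 / √D := by
  set I : G → ℂ := fun g => ∫ x, f₁ x * f₂ (g * x) * f₃ (x * g) ∂μ with hI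
  have hIc : Continuous I := Continuous.integral_of_compactSpace (by fun_prop)
  have hI1 : ∀ g, ‖I g‖ ≤ 1 := fun g => norm_integral_le_of_forall_norm_le fun x => by
    rw [norm_mul, norm_mul]
    exact mul_le_one₀ (mul_le_one₀ (hb₁ _) (norm_nonneg _) (hb₂ _)) (norm_nonneg _) (hb₃ _)
  -- The choice `ψ = conj I` turns the pairing into the squared `L²` norm of `I`.
  have key := hG.sq_norm_integral_triple_le (μ := μ) hD (ψ := fun g => conj (I g)) (by fun_prop)
    h₁ h₂ h₃ (by simpa using hI1) hb₁ hb₂ hb₃ hf₁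
  have hs : ∫ g, conj (I g) * I g ∂μ = ((∫ g, ‖I g‖ ^ 2 ∂μ : ℝ) : ℂ) := by
    rw [← integral_complex_ofReal]
    congr with g
    rw [mul_comm, Complex.mul_conj, Complex.normSq_eq_norm_sq]
  change ‖∫ g, conj (I g) * I g ∂μ‖ ^ 2 ≤ _ at key
  rw [hs, Complex.norm_real, Real.norm_eq_abs, sq_abs] at key
  calc (∫ g, ‖I g‖ ∂μ) ^ 4 = ((∫ g, ‖I g‖ ∂μ) ^ 2) ^ 2 := by ring
    _ ≤ (∫ g, ‖I g‖ ^ 2 ∂μ) ^ 2 := by gcongr; exact hIc.sq_integral_norm_le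
    _ ≤ _ := key

/-- The average of a function over conjugacy classes. -/
noncomputable def conjAverage (μ : Measure G) (f : G → ℂ) (x : G) : ℂ :=
  ∫ g, f (g⁻¹ * x * g) ∂μ

theorem Continuous.conjAverage {f : G → ℂ} (hf : Continuous f) : Continuous (conjAverage μ f) :=
  Continuous.integral_of_compactSpace (F := fun x g => f (g⁻¹ * x * g)) (by fun_prop)

theorem conjAverage_conj (f : G → ℂ) (x h : G) :
    conjAverage μ f (h⁻¹ * x * h) = conjAverage μ f x := by
  rw [conjAverage, conjAverage, ← integral_mul_left_eq_self (fun g => f (g⁻¹ * x * g)) h]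
  simp [mul_assoc]

theorem measurePreserving_conj (g : G) : MeasurePreserving (fun x => g⁻¹ * x * g) μ μ :=
  (measurePreserving_mul_right μ g).comp (measurePreserving_mul_left μ g⁻¹)

theorem integral_conj_eq_self (f : G → ℂ) (g : G) :
    ∫ x, f (g⁻¹ * x * g) ∂μ = ∫ x, f x ∂μ := by
  rw [integral_mul_left_eq_self (fun x => f (x * g)), integral_mul_right_eq_self f]

/-- Class averaging acts as an orthogonal projection: the second factor is already conjugation
invariant, so averaging the first is redundant. -/
theorem integral_mul_conjAverage {f₂ f₃ : G → ℂ} (h₂ : Continuous f₂) (h₃ : Continuous f₃) :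
    ∫ x, conjAverage μ f₂ x * conjAverage μ f₃ x ∂μ = ∫ x, f₂ x * conjAverage μ f₃ x ∂μ := by
  have := h₃.conjAverage (μ := μ)
  calc _ = ∫ x, ∫ g, f₂ (g⁻¹ * x * g) * conjAverage μ f₃ x ∂μ ∂μ := by
        simp_rw [integral_mul_const]; rfl
    _ = ∫ g, ∫ x, f₂ (g⁻¹ * x * g) * conjAverage μ f₃ x ∂μ ∂μ :=
        Continuous.integral_integral_swap (by fun_prop)
    _ = ∫ g, ∫ x, f₂ x * conjAverage μ f₃ x ∂μ ∂μ := by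
        congr with g
        rw [← integral_conj_eq_self (fun x => f₂ x * _) g]
        simp_rw [conjAverage_conj]
    _ = _ := by simp

/-- Replacing `x` by `g⁻¹ * x` exhibits the conjugation action. Subtracting the class average from
`f₃` kills the orbit averages and at most doubles the sup bound. -/
theorem IsQuasirandom.integral_norm_conj_correlation_le (hG : IsQuasirandom D G) (hD : 0 < D)
    {f₂ f₃ : G → ℂ} (h₂ : Continuous f₂) (h₃ : Continuous f₃) (hb₂ : ∀ x, ‖f₂ x‖ ≤ 1)
    (hb₃ : ∀ x, ‖f₃ x‖ ≤ 1) :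
    ∫ g, ‖∫ x, f₂ (g * x) * f₃ (x * g) ∂μ - ∫ x, conjAverage μ f₂ x * conjAverage μ f₃ x ∂μ‖ ∂μ
      ≤ 2 / √D := by
  have hc := h₃.conjAverage (μ := μ)
  have h : ∀ g, ∫ x, f₂ (g * x) * f₃ (x * g) ∂μ - ∫ x, conjAverage μ f₂ x * conjAverage μ f₃ x ∂μ
      = ∫ x, f₂ x * (f₃ (g⁻¹ * x * g) - conjAverage μ f₃ (g⁻¹ * x * g)) ∂μ := fun g => by
    have i1 : Integrable (fun x => f₂ x * f₃ (g⁻¹ * x * g)) μ :=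
      Continuous.integrable_of_compactSpace (by fun_prop) μ
    have i2 : Integrable (fun x => f₂ x * conjAverage μ f₃ x) μ :=
      Continuous.integrable_of_compactSpace (by fun_prop) μ
    simp_rw [conjAverage_conj, mul_sub]
    rw [integral_sub i1 i2, integral_mul_conjAverage h₂ h₃, ← integral_mul_left_eq_self _ g⁻¹]
    simp
  have hcont : Continuous fun g =>
      ∫ x, f₂ x * (f₃ (g⁻¹ * x * g) - conjAverage μ f₃ (g⁻¹ * x * g)) ∂μ :=
    Continuous.integral_of_compactSpace (by fun_prop)
  simp_rw [h]
  have hbound := hG.integral_norm_correlation_sq_le (μ := μ) hD (b := fun g x => g⁻¹ * x * g)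
    (v := fun x => f₃ x - conjAverage μ f₃ x) (A := 1) (B := 2)
    (by fun_prop) (by simp) (by simp [mul_assoc]) measurePreserving_conj h₂ (by fun_prop) hb₂
    (fun x => (norm_sub_le _ _).trans (by
      have : ‖conjAverage μ f₃ x‖ ≤ 1 := norm_integral_le_of_forall_norm_le fun g => hb₃ _
      linarith [hb₃ x]))
    (fun x => by
      have i1 : Integrable (fun g => f₃ (g⁻¹ * x * g)) μ :=
        Continuous.integrable_of_compactSpace (by fun_prop) μ
      simp_rw [conjAverage_conj]
      rw [integral_sub i1 (integrable_const _)]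
      simp [conjAverage])
  refine abs_le_of_sq_le_sq' ?_ (by positivity) |>.2
  refine (hcont.sq_integral_norm_le.trans hbound).trans (le_of_eq ?_)
  rw [div_pow, Real.sq_sqrt hD.le]; norm_num

end Correlations

/-! ### Stability in `L¹` and approximation by continuous functions. -/

section Approximation

set_option linter.unusedSectionVars false

variable {G : Type*} {m m₀ : MeasurableSpace G} {μ : Measure G} [IsProbabilityMeasure μ]

theorem norm_mul_mul_sub_mul_mul_le {a b c a' b' c' : ℂ} (hb : ‖b‖ ≤ 1) (hc : ‖c‖ ≤ 1)
    (ha' : ‖a'‖ ≤ 1) (hb' : ‖b'‖ ≤ 1) :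
    ‖a * b * c - a' * b' * c'‖ ≤ ‖a - a'‖ + ‖b - b'‖ + ‖c - c'‖ := by
  have h : a * b * c - a' * b' * c' = (a - a') * b * c + a' * (b - b') * c + a' * b' * (c - c') := by
    ring
  rw [h]
  refine norm_add₃_le.trans ?_
  simp only [norm_mul]
  gcongr
  · calc _ ≤ ‖a - a'‖ * 1 * 1 := by gcongr
      _ = _ := by ring
  · calc _ ≤ 1 * ‖b - b'‖ * 1 := by gcongr
      _ = _ := by ring
  · calc _ ≤ 1 * 1 * ‖c - c'‖ := by gcongr
      _ = _ := by ring

theorem integrable_of_ae_norm_le_one {a : G → ℂ} (ha : AEStronglyMeasurable a μ)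
    (hb : ∀ᵐ x ∂μ, ‖a x‖ ≤ 1) : Integrable a μ :=
  Integrable.of_bound ha 1 hb

theorem ae_norm_mul_le_one {a b : G → ℂ} (ha : ∀ᵐ x ∂μ, ‖a x‖ ≤ 1) (hb : ∀ᵐ x ∂μ, ‖b x‖ ≤ 1) :
    ∀ᵐ x ∂μ, ‖a x * b x‖ ≤ 1 := by
  filter_upwards [ha, hb] with x h1 h2
  rw [norm_mul]
  exact mul_le_one₀ h1 (norm_nonneg _) h2

theorem norm_integral_mul_mul_sub_le {a b c a' b' c' : G → ℂ}
    (ha : AEStronglyMeasurable a μ) (hb : AEStronglyMeasurable b μ) (hc : AEStronglyMeasurable c μ)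
    (ha' : AEStronglyMeasurable a' μ) (hb' : AEStronglyMeasurable b' μ)
    (hc' : AEStronglyMeasurable c' μ)
    (ha1 : ∀ᵐ x ∂μ, ‖a x‖ ≤ 1) (hb1 : ∀ᵐ x ∂μ, ‖b x‖ ≤ 1) (hc1 : ∀ᵐ x ∂μ, ‖c x‖ ≤ 1)
    (ha1' : ∀ᵐ x ∂μ, ‖a' x‖ ≤ 1) (hb1' : ∀ᵐ x ∂μ, ‖b' x‖ ≤ 1) (hc1' : ∀ᵐ x ∂μ, ‖c' x‖ ≤ 1) :
    ‖∫ x, a x * b x * c x ∂μ - ∫ x, a' x * b' x * c' x ∂μ‖ ≤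
      ∫ x, ‖a x - a' x‖ ∂μ + ∫ x, ‖b x - b' x‖ ∂μ + ∫ x, ‖c x - c' x‖ ∂μ := by
  have i1 : Integrable (fun x => a x * b x * c x) μ := integrable_of_ae_norm_le_one
    ((ha.mul hb).mul hc) (ae_norm_mul_le_one (ae_norm_mul_le_one ha1 hb1) hc1)
  have i2 : Integrable (fun x => a' x * b' x * c' x) μ := integrable_of_ae_norm_le_one
    ((ha'.mul hb').mul hc') (ae_norm_mul_le_one (ae_norm_mul_le_one ha1' hb1') hc1')
  have ia : Integrable (fun x => ‖a x - a' x‖) μ := ((integrable_of_ae_norm_le_one ha ha1).sub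
    (integrable_of_ae_norm_le_one ha' ha1')).norm
  have ib : Integrable (fun x => ‖b x - b' x‖) μ := ((integrable_of_ae_norm_le_one hb hb1).sub
    (integrable_of_ae_norm_le_one hb' hb1')).norm
  have ic : Integrable (fun x => ‖c x - c' x‖) μ := ((integrable_of_ae_norm_le_one hc hc1).sub
    (integrable_of_ae_norm_le_one hc' hc1')).norm
  have iab : Integrable (fun x => ‖a x - a' x‖ + ‖b x - b' x‖) μ := ia.add ib
  rw [← integral_sub i1 i2, ← integral_add ia ib, ← integral_add iab ic]
  refine (norm_integral_le_integral_norm _).trans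
    (integral_mono_ae (i1.sub i2).norm (iab.add ic) ?_)
  filter_upwards [hb1, hc1, ha1', hb1'] with x h2 h3 h4 h5
  exact norm_mul_mul_sub_mul_mul_le h2 h3 h4 h5

/-- Conditional expectation contracts `L¹` and preserves the bound `1`. -/
theorem norm_integral_condExp_mul_sub_le {b c b' c' : G → ℂ}
    (hb : Measurable b) (hc : Measurable c) (hb' : Measurable b') (hc' : Measurable c')
    (hb1 : ∀ x, ‖b x‖ ≤ 1) (hc1 : ∀ x, ‖c x‖ ≤ 1)
    (hb1' : ∀ x, ‖b' x‖ ≤ 1) (hc1' : ∀ x, ‖c' x‖ ≤ 1) :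
    ‖∫ x, (μ[b|m]) x * (μ[c|m]) x ∂μ - ∫ x, (μ[b'|m]) x * (μ[c'|m]) x ∂μ‖ ≤
      ∫ x, ‖b x - b' x‖ ∂μ + ∫ x, ‖c x - c' x‖ ∂μ := by
  have hcontr : ∀ {f f' : G → ℂ}, Measurable f → Measurable f' → (∀ x, ‖f x‖ ≤ 1) →
      (∀ x, ‖f' x‖ ≤ 1) →
      ∫ x, ‖(μ[f|m]) x - (μ[f'|m]) x‖ ∂μ ≤ ∫ x, ‖f x - f' x‖ ∂μ := by
    intro f f' hf hf' h1 h1'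
    have i := integrable_of_ae_norm_le_one hf.aestronglyMeasurable (.of_forall h1) (μ := μ)
    have i' := integrable_of_ae_norm_le_one hf'.aestronglyMeasurable (.of_forall h1') (μ := μ)
    refine le_trans (le_of_eq (integral_congr_ae ?_)) (integral_norm_condExp_le (m := m) (f - f'))
    filter_upwards [condExp_sub i i' m] with x hx
    rw [hx, Pi.sub_apply]
  have hmeas : ∀ f : G → ℂ, AEStronglyMeasurable (μ[f|m]) μ := fun f =>
    integrable_condExp.aestronglyMeasurable
  have hbd : ∀ {f : G → ℂ}, (∀ x, ‖f x‖ ≤ 1) → ∀ᵐ x ∂μ, ‖(μ[f|m]) x‖ ≤ 1 := fun h =>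
    ae_bdd_norm_condExp_of_ae_bdd_norm (.of_forall h)
  have h := norm_integral_mul_mul_sub_le (μ := μ) (a := fun _ => 1) (a' := fun _ => 1)
    (by fun_prop) (hmeas b) (hmeas c) (by fun_prop) (hmeas b') (hmeas c') (by simp) (hbd hb1)
    (hbd hc1) (by simp) (hbd hb1') (hbd hc1')
  simp only [one_mul, sub_self, norm_zero, integral_zero, zero_add] at h
  exact h.trans (add_le_add (hcontr hb hb' hb1 hb1') (hcontr hc hc' hc1 hc1'))

theorem norm_integral_condExp_mul_le_one {b c : G → ℂ}
    (hb1 : ∀ x, ‖b x‖ ≤ 1) (hc1 : ∀ x, ‖c x‖ ≤ 1) :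
    ‖∫ x, (μ[b|m]) x * (μ[c|m]) x ∂μ‖ ≤ 1 := by
  simpa using norm_integral_le_of_norm_le_const (ae_norm_mul_le_one (μ := μ)
    (ae_bdd_norm_condExp_of_ae_bdd_norm (m := m) (.of_forall hb1))
    (ae_bdd_norm_condExp_of_ae_bdd_norm (m := m) (.of_forall hc1)))

/-- A measurable function with values in the closed unit disc is approximated in `L¹` by
continuous functions with values in the closed unit disc. -/
theorem exists_continuous_norm_le_one_integral_sub_le [TopologicalSpace G] [T2Space G]
    [CompactSpace G] [BorelSpace G] [μ.Regular] {f : G → ℂ} (hf : Measurable f)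
    (hf1 : ∀ x, ‖f x‖ ≤ 1) {ε : ℝ} (hε : 0 < ε) :
    ∃ f' : G → ℂ, Continuous f' ∧ (∀ x, ‖f' x‖ ≤ 1) ∧ ∫ x, ‖f x - f' x‖ ∂μ ≤ ε := by
  have i := integrable_of_ae_norm_le_one hf.aestronglyMeasurable (.of_forall hf1) (μ := μ)
  obtain ⟨z, -, hz, hzc, hzi⟩ := i.exists_hasCompactSupport_integral_sub_le (half_pos hε)
  have hpos : ∀ x, 0 < max 1 ‖z x‖ := fun x => lt_max_of_lt_left one_pos
  -- Radial retraction onto the unit disc; it at most doubles the distance to `f`, which is why `z`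
  -- was taken within `ε / 2`.
  let p : G → ℂ := fun x => ((max 1 ‖z x‖)⁻¹ : ℝ) • z x
  have hp : Continuous p := by
    have : Continuous fun x => (max 1 ‖z x‖)⁻¹ :=
      (continuous_const.max hzc.norm).inv₀ fun x => (hpos x).ne'
    exact this.smul hzc
  have hnorm : ∀ x, ‖p x‖ = (max 1 ‖z x‖)⁻¹ * ‖z x‖ := fun x => by
    rw [norm_smul, Real.norm_of_nonneg (inv_nonneg.2 (hpos x).le)]
  have hzp : ∀ x, ‖f x - p x‖ ≤ 2 * ‖f x - z x‖ := fun x => by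
    rcases le_total ‖z x‖ 1 with h | h
    · have : p x = z x := by simp [p, max_eq_left h]
      rw [this]; linarith [norm_nonneg (f x - z x)]
    · have h1 : ‖z x - p x‖ = ‖z x‖ - 1 := by
        have h0 : z x - p x = ((1 - ‖z x‖⁻¹ : ℝ)) • z x := by
          simp only [p, max_eq_right h, sub_smul, one_smul]
        rw [h0, norm_smul, Real.norm_of_nonneg (sub_nonneg.2 (inv_le_one_of_one_le₀ h)), sub_mul,
          inv_mul_cancel₀ (by linarith), one_mul]
      have h2 : ‖z x‖ - 1 ≤ ‖f x - z x‖ := by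
        have := norm_sub_norm_le (z x) (f x)
        rw [norm_sub_rev] at this
        linarith [hf1 x]
      calc ‖f x - p x‖ ≤ ‖f x - z x‖ + ‖z x - p x‖ := norm_sub_le_norm_sub_add_norm_sub _ _ _
        _ ≤ _ := by linarith
  refine ⟨p, hp, fun x => ?_, ?_⟩
  · rw [hnorm, inv_mul_le_iff₀ (hpos x), mul_one]
    exact le_max_right _ _
  · calc ∫ x, ‖f x - p x‖ ∂μ ≤ ∫ x, 2 * ‖f x - z x‖ ∂μ :=
          integral_mono_of_nonneg (.of_forall fun x => norm_nonneg _)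
            ((i.sub hzi).norm.const_mul 2) (.of_forall hzp)
      _ ≤ ε := by rw [integral_const_mul]; linarith

end Approximation

/-! ### Conditional expectation as class average, and the bound for continuous functions. -/

section Main

set_option linter.unusedSectionVars false

variable {G : Type*} [Group G] [TopologicalSpace G] [IsTopologicalGroup G]
    [CompactSpace G] [T2Space G] [MeasurableSpace G] [BorelSpace G]
    {μ : Measure G} [IsProbabilityMeasure μ] [μ.Regular] [μ.IsMulLeftInvariant]
    [μ.IsMulRightInvariant] {D : ℝ}

/-- The conditional expectation on the conjugation-invariant sets is the average over conjugacy
classes. -/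
theorem condExp_conjInvariant_ae_eq {f : G → ℂ} (hf : Continuous f) :
    μ[f|conjInvariant G] =ᵐ[μ] conjAverage μ f := by
  have hc := hf.conjAverage (μ := μ)
  refine (ae_eq_condExp_of_forall_setIntegral_eq (conjInvariant_le G)
    (hf.integrable_of_compactSpace μ) (fun s _ _ => (hc.integrable_of_compactSpace μ).integrableOn)
    (fun s hs _ => ?_) ?_).symm
  -- Conjugation preserves both `μ` and the invariant set `s`, so each inner integral equals that of
  -- `f` over `s`.
  · calc ∫ x in s, conjAverage μ f x ∂μ = ∫ g, ∫ x in s, f (g⁻¹ * x * g) ∂μ ∂μ :=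
          Continuous.integral_integral_swap (F := fun x g => f (g⁻¹ * x * g)) (by fun_prop)
      _ = ∫ g, ∫ x in s, f x ∂μ ∂μ := by
          congr with g
          have hpre : (fun x => g⁻¹ * x * g) ⁻¹' s = s := by simpa using hs.2 g⁻¹
          have hmp := (measurePreserving_conj (μ := μ) g).restrict_preimage hs.1
          rw [hpre] at hmp
          rw [← integral_map (f := f) hmp.measurable.aemeasurable
            hf.measurable.aestronglyMeasurable, hmp.map_eq]
      _ = _ := by simp
  · refine StronglyMeasurable.aestronglyMeasurable (Measurable.stronglyMeasurable ?_)
    refine fun t ht => ⟨hc.measurable ht, fun g => ?_⟩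
    ext x
    have := conjAverage_conj (μ := μ) f x g⁻¹
    rw [inv_inv] at this
    simp only [Set.mem_preimage, this]

theorem IsQuasirandom.integral_norm_triple_sub_le_of_continuous (hG : IsQuasirandom D G)
    (hD : 256 ≤ D) {f₁ f₂ f₃ : G → ℂ} (h₁ : Continuous f₁) (h₂ : Continuous f₂)
    (h₃ : Continuous f₃) (hb₁ : ∀ x, ‖f₁ x‖ ≤ 1) (hb₂ : ∀ x, ‖f₂ x‖ ≤ 1)
    (hb₃ : ∀ x, ‖f₃ x‖ ≤ 1) :
    ∫ g, ‖(∫ x, f₁ x * f₂ (g * x) * f₃ (x * g) ∂μ) -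
      (∫ x, f₁ x ∂μ) * ∫ x, (μ[f₂|conjInvariant G]) x * (μ[f₃|conjInvariant G]) x ∂μ‖ ∂μ
      ≤ 4 * D ^ (-(1 / 8) : ℝ) := by
  have hD0 : 0 < D := by linarith
  have hcond : ∫ x, (μ[f₂|conjInvariant G]) x * (μ[f₃|conjInvariant G]) x ∂μ =
      ∫ x, conjAverage μ f₂ x * conjAverage μ f₃ x ∂μ := by
    refine integral_congr_ae ?_
    filter_upwards [condExp_conjInvariant_ae_eq (μ := μ) h₂,
      condExp_conjInvariant_ae_eq (μ := μ) h₃] with x h2 h3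
    rw [h2, h3]
  rw [hcond]
  set q := ∫ x, conjAverage μ f₂ x * conjAverage μ f₃ x ∂μ with hq
  set c := ∫ x, f₁ x ∂μ with hc
  have hc1 : ‖c‖ ≤ 1 := norm_integral_le_of_forall_norm_le hb₁
  -- Halving keeps the centred function in the unit disc; the factor returns as `2 * I g`.
  let f₀ : G → ℂ := fun x => (f₁ x - c) / 2
  have h₀ : Continuous f₀ := by fun_prop
  have hb₀ : ∀ x, ‖f₀ x‖ ≤ 1 := fun x => by
    rw [norm_div, Complex.norm_ofNat, div_le_one (by norm_num)]
    exact (norm_sub_le _ _).trans (by linarith [hb₁ x])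
  have hf₀ : ∫ x, f₀ x ∂μ = 0 := by
    rw [integral_div, integral_sub (h₁.integrable_of_compactSpace μ) (integrable_const _)]
    simp [hc]
  let I : G → ℂ := fun g => ∫ x, f₀ x * f₂ (g * x) * f₃ (x * g) ∂μ
  let K : G → ℂ := fun g => ∫ x, f₂ (g * x) * f₃ (x * g) ∂μ - q
  have hI : Continuous I := Continuous.integral_of_compactSpace (by fun_prop)
  have hK : Continuous K :=
    Continuous.sub (Continuous.integral_of_compactSpace (by fun_prop)) continuous_const
  have hsplit : ∀ g, (∫ x, f₁ x * f₂ (g * x) * f₃ (x * g) ∂μ) - c * q = 2 * I g + c * K g := by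
    intro g
    have i1 : Integrable (fun x => 2 * (f₀ x * f₂ (g * x) * f₃ (x * g))) μ :=
      Continuous.integrable_of_compactSpace (by fun_prop) μ
    have i2 : Integrable (fun x => c * (f₂ (g * x) * f₃ (x * g))) μ :=
      Continuous.integrable_of_compactSpace (by fun_prop) μ
    have h : ∫ x, f₁ x * f₂ (g * x) * f₃ (x * g) ∂μ =
        2 * I g + c * ∫ x, f₂ (g * x) * f₃ (x * g) ∂μ := by
      rw [← integral_const_mul, ← integral_const_mul, ← integral_add i1 i2]
      congr with x
      simp only [f₀]
      ring
    rw [h]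
    simp only [K]
    ring
  have hI4 := hG.integral_norm_triple_pow_four_le (μ := μ) hD0 h₀ h₂ h₃ hb₀ hb₂ hb₃ hf₀
  have hK1 := hG.integral_norm_conj_correlation_le (μ := μ) hD0 h₂ h₃ hb₂ hb₃
  change (∫ g, ‖I g‖ ∂μ) ^ 4 ≤ _ at hI4
  change ∫ g, ‖K g‖ ∂μ ≤ _ at hK1
  set t : ℝ := D ^ (-(1 / 8) : ℝ) with ht
  have ht0 : 0 < t := Real.rpow_pos_of_pos hD0 _
  have ht4 : 1 / √D = t ^ 4 := by
    rw [ht, ← Real.rpow_natCast, ← Real.rpow_mul hD0.le, Real.sqrt_eq_rpow, one_div,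
      ← Real.rpow_neg hD0.le]
    norm_num
  have ht2 : t ^ 3 ≤ 1 / 8 := by
    have h1 : t ^ 8 ≤ (1 / 2) ^ 8 := by
      rw [ht, ← Real.rpow_natCast, ← Real.rpow_mul hD0.le]
      norm_num [Real.rpow_neg_one]
      exact (inv_anti₀ (by norm_num) hD).trans (by norm_num)
    have h2 : t ≤ 1 / 2 := le_of_pow_le_pow_left₀ (by norm_num) (by norm_num) h1
    calc t ^ 3 ≤ (1 / 2) ^ 3 := by gcongr
      _ = _ := by norm_num
  -- Any constant whose fourth power is at least `3` works; `3 / 2` makes the final sum `13 / 4 * t`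
  -- at most.
  have hI' : ∫ g, ‖I g‖ ∂μ ≤ 3 / 2 * t := by
    refine le_of_pow_le_pow_left₀ (n := 4) (by norm_num) (by positivity) (hI4.trans ?_)
    rw [← mul_one_div, ht4, mul_pow]
    gcongr
    norm_num
  calc _ ≤ ∫ g, (2 * ‖I g‖ + ‖K g‖) ∂μ := by
        refine integral_mono_of_nonneg (.of_forall fun g => norm_nonneg _)
          (Continuous.integrable_of_compactSpace (by fun_prop) μ) (.of_forall fun g => ?_)
        simp only [hsplit]
        refine (norm_add_le _ _).trans ?_
        rw [norm_mul, norm_mul, Complex.norm_ofNat]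
        gcongr
        exact mul_le_of_le_one_left (norm_nonneg _) hc1
    _ = 2 * ∫ g, ‖I g‖ ∂μ + ∫ g, ‖K g‖ ∂μ := by
        rw [integral_add ((hI.norm.integrable_of_compactSpace μ).const_mul 2)
          (hK.norm.integrable_of_compactSpace μ), integral_const_mul]
    _ ≤ 2 * (3 / 2 * t) + 2 * t ^ 4 := by
        gcongr
        rw [← ht4, mul_one_div]
        exact hK1
    _ = 3 * t + 2 * (t ^ 3 * t) := by ring
    _ ≤ 3 * t + 2 * (1 / 8 * t) := by gcongr
    _ ≤ 4 * t := by linarith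

end Main

/-! ### Measurable functions and the full range of `D`. -/

theorem theorem1 {G : Type*} [Group G] [TopologicalSpace G] [IsTopologicalGroup G]
    [CompactSpace G] [T2Space G] [MeasurableSpace G] [BorelSpace G]
    (μ : Measure G) [μ.IsHaarMeasure] [IsProbabilityMeasure μ] [μ.Regular]
    (D : ℝ) (hD : 0 < D) (hG : IsQuasirandom D G)
    (f₁ f₂ f₃ : G → ℂ) (hm₁ : Measurable f₁) (hm₂ : Measurable f₂) (hm₃ : Measurable f₃)
    (hb₁ : ∀ x, ‖f₁ x‖ ≤ 1) (hb₂ : ∀ x, ‖f₂ x‖ ≤ 1) (hb₃ : ∀ x, ‖f₃ x‖ ≤ 1) :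
    Integrable (fun g => ‖(∫ x, f₁ x * f₂ (g * x) * f₃ (x * g) ∂μ) -
      (∫ x, f₁ x ∂μ) * ∫ x, (μ[f₂|conjInvariant G]) x * (μ[f₃|conjInvariant G]) x ∂μ‖) μ ∧
    ∫ g, ‖(∫ x, f₁ x * f₂ (g * x) * f₃ (x * g) ∂μ) -
      (∫ x, f₁ x ∂μ) * ∫ x, (μ[f₂|conjInvariant G]) x * (μ[f₃|conjInvariant G]) x ∂μ‖ ∂μ
      ≤ 4 * D ^ (-(1 / 8) : ℝ) := by
  have hright : μ.IsMulRightInvariant := isMulRightInvariant_of_compactSpace μ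
  let Q : (G → ℂ) → (G → ℂ) → ℂ := fun f f' =>
    ∫ x, (μ[f|conjInvariant G]) x * (μ[f'|conjInvariant G]) x ∂μ
  let F : (G → ℂ) → (G → ℂ) → (G → ℂ) → G → ℂ := fun f f' f'' g =>
    (∫ x, f x * f' (g * x) * f'' (x * g) ∂μ) - (∫ x, f x ∂μ) * Q f' f''
  change Integrable (fun g => ‖F f₁ f₂ f₃ g‖) μ ∧ ∫ g, ‖F f₁ f₂ f₃ g‖ ∂μ ≤ _
  have happrox : ∀ ε > 0, ∃ f₁' f₂' f₃' : G → ℂ, (Continuous f₁' ∧ ∀ x, ‖f₁' x‖ ≤ 1) ∧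
      (Continuous f₂' ∧ ∀ x, ‖f₂' x‖ ≤ 1) ∧ (Continuous f₃' ∧ ∀ x, ‖f₃' x‖ ≤ 1) ∧
      ∀ g, ‖F f₁ f₂ f₃ g - F f₁' f₂' f₃' g‖ ≤ ε := by
    intro ε hε
    -- Six errors: three from the triple correlation, one from the mean of `f₁`, two from the
    -- conditional expectations.
    have hε6 : 0 < ε / 6 := by positivity
    obtain ⟨f₁', hc₁, hb₁', he₁⟩ :=
      exists_continuous_norm_le_one_integral_sub_le (μ := μ) hm₁ hb₁ hε6
    obtain ⟨f₂', hc₂, hb₂', he₂⟩ :=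
      exists_continuous_norm_le_one_integral_sub_le (μ := μ) hm₂ hb₂ hε6
    obtain ⟨f₃', hc₃, hb₃', he₃⟩ :=
      exists_continuous_norm_le_one_integral_sub_le (μ := μ) hm₃ hb₃ hε6
    refine ⟨f₁', f₂', f₃', ⟨hc₁, hb₁'⟩, ⟨hc₂, hb₂'⟩, ⟨hc₃, hb₃'⟩, fun g => ?_⟩
    have hT : ‖(∫ x, f₁ x * f₂ (g * x) * f₃ (x * g) ∂μ) -
        ∫ x, f₁' x * f₂' (g * x) * f₃' (x * g) ∂μ‖ ≤ ε / 6 + ε / 6 + ε / 6 := by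
      refine (norm_integral_mul_mul_sub_le hm₁.aestronglyMeasurable
        (hm₂.comp (measurable_const_mul g)).aestronglyMeasurable
        (hm₃.comp (measurable_mul_const g)).aestronglyMeasurable
        hc₁.measurable.aestronglyMeasurable
        (hc₂.measurable.comp (measurable_const_mul g)).aestronglyMeasurable
        (hc₃.measurable.comp (measurable_mul_const g)).aestronglyMeasurable
        (.of_forall hb₁) (.of_forall fun x => hb₂ _) (.of_forall fun x => hb₃ _)
        (.of_forall hb₁') (.of_forall fun x => hb₂' _) (.of_forall fun x => hb₃' _)).trans ?_
      simp only [Function.comp_apply]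
      rw [integral_mul_left_eq_self (fun x => ‖f₂ x - f₂' x‖) g,
        integral_mul_right_eq_self (fun x => ‖f₃ x - f₃' x‖) g]
      gcongr
    have hS : ‖∫ x, f₁ x ∂μ - ∫ x, f₁' x ∂μ‖ ≤ ε / 6 := by
      rw [← integral_sub (integrable_of_ae_norm_le_one hm₁.aestronglyMeasurable (.of_forall hb₁))
        (hc₁.integrable_of_compactSpace μ)]
      exact (norm_integral_le_integral_norm _).trans he₁
    have hQ : ‖Q f₂ f₃ - Q f₂' f₃'‖ ≤ ε / 6 + ε / 6 :=
      (norm_integral_condExp_mul_sub_le hm₂ hm₃ hc₂.measurable hc₃.measurable hb₂ hb₃ hb₂'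
        hb₃').trans (add_le_add he₂ he₃)
    have hQ1 : ‖Q f₂ f₃‖ ≤ 1 := norm_integral_condExp_mul_le_one hb₂ hb₃
    have hS1 : ‖∫ x, f₁' x ∂μ‖ ≤ 1 := norm_integral_le_of_forall_norm_le hb₁'
    have hSQ : ‖(∫ x, f₁ x ∂μ) * Q f₂ f₃ - (∫ x, f₁' x ∂μ) * Q f₂' f₃'‖ ≤
        ε / 6 + (ε / 6 + ε / 6) := by
      have h : (∫ x, f₁ x ∂μ) * Q f₂ f₃ - (∫ x, f₁' x ∂μ) * Q f₂' f₃' =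
          (∫ x, f₁ x ∂μ - ∫ x, f₁' x ∂μ) * Q f₂ f₃ +
          (∫ x, f₁' x ∂μ) * (Q f₂ f₃ - Q f₂' f₃') := by ring
      rw [h]
      refine (norm_add_le _ _).trans (add_le_add ?_ ?_) <;> rw [norm_mul]
      · exact (mul_le_of_le_one_right (norm_nonneg _) hQ1).trans hS
      · exact (mul_le_of_le_one_left (norm_nonneg _) hS1).trans hQ
    calc ‖F f₁ f₂ f₃ g - F f₁' f₂' f₃' g‖
        = ‖((∫ x, f₁ x * f₂ (g * x) * f₃ (x * g) ∂μ) -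
            ∫ x, f₁' x * f₂' (g * x) * f₃' (x * g) ∂μ) -
          ((∫ x, f₁ x ∂μ) * Q f₂ f₃ - (∫ x, f₁' x ∂μ) * Q f₂' f₃')‖ := by
          congr 1; simp only [F]; ring
      _ ≤ _ := norm_sub_le _ _
      _ ≤ (ε / 6 + ε / 6 + ε / 6) + (ε / 6 + (ε / 6 + ε / 6)) := add_le_add hT hSQ
      _ = ε := by ring
  have hFc : ∀ {f f' f'' : G → ℂ}, Continuous f → Continuous f' → Continuous f'' →
      Continuous (F f f' f'') := fun h h' h'' =>
    Continuous.sub (Continuous.integral_of_compactSpace (by fun_prop)) continuous_const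
  -- A uniform limit of continuous functions of `g`, which also gives integrability.
  have hcont : Continuous (F f₁ f₂ f₃) := by
    refine continuous_of_uniform_approx_of_continuous fun u hu => ?_
    obtain ⟨ε, hε, hεu⟩ := Metric.mem_uniformity_dist.1 hu
    obtain ⟨f₁', f₂', f₃', h₁, h₂, h₃, h⟩ := happrox (ε / 2) (half_pos hε)
    refine ⟨F f₁' f₂' f₃', hFc h₁.1 h₂.1 h₃.1, fun g => hεu ?_⟩
    rw [dist_eq_norm]
    exact (h g).trans_lt (half_lt_self hε)
  refine ⟨hcont.norm.integrable_of_compactSpace μ, ?_⟩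
  -- Since `256 ^ (-1/8) = 1/2`, below this threshold the trivial bound `2` suffices.
  rcases le_or_gt 256 D with hD' | hD'
  · refine le_of_forall_pos_le_add fun ε hε => ?_
    obtain ⟨f₁', f₂', f₃', h₁, h₂, h₃, h⟩ := happrox ε hε
    have hint := ((hFc h₁.1 h₂.1 h₃.1).norm.integrable_of_compactSpace μ)
    calc ∫ g, ‖F f₁ f₂ f₃ g‖ ∂μ ≤ ∫ g, (‖F f₁' f₂' f₃' g‖ + ε) ∂μ := by
          refine integral_mono (hcont.norm.integrable_of_compactSpace μ)
            (hint.add (integrable_const ε)) fun g => ?_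
          have := norm_sub_norm_le (F f₁ f₂ f₃ g) (F f₁' f₂' f₃' g)
          simp only
          linarith [h g]
      _ = ∫ g, ‖F f₁' f₂' f₃' g‖ ∂μ + ε := by
          rw [integral_add hint (integrable_const ε)]; simp
      _ ≤ _ := by
          gcongr
          exact hG.integral_norm_triple_sub_le_of_continuous hD' h₁.1 h₂.1 h₃.1 h₁.2 h₂.2 h₃.2
  · have h1 : ∀ g, ‖F f₁ f₂ f₃ g‖ ≤ 2 := fun g => by
      have hT : ‖∫ x, f₁ x * f₂ (g * x) * f₃ (x * g) ∂μ‖ ≤ 1 :=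
        norm_integral_le_of_forall_norm_le fun x => by
          rw [norm_mul, norm_mul]
          exact mul_le_one₀ (mul_le_one₀ (hb₁ _) (norm_nonneg _) (hb₂ _)) (norm_nonneg _) (hb₃ _)
      have hS : ‖(∫ x, f₁ x ∂μ) * Q f₂ f₃‖ ≤ 1 := by
        rw [norm_mul]
        exact mul_le_one₀ (norm_integral_le_of_forall_norm_le hb₁) (norm_nonneg _)
          (norm_integral_condExp_mul_le_one hb₂ hb₃)
      exact (norm_sub_le _ _).trans (by linarith)
    have h2 : (2 : ℝ) ≤ 4 * D ^ (-(1 / 8) : ℝ) := by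
      have h3 : (256 : ℝ) ^ (-(1 / 8) : ℝ) = 1 / 2 := by
        rw [show (256 : ℝ) = 2 ^ (8 : ℝ) by norm_num, ← Real.rpow_mul (by norm_num)]
        norm_num [Real.rpow_neg_one]
      have := Real.rpow_le_rpow_of_nonpos hD hD'.le (by norm_num : (-(1 / 8) : ℝ) ≤ 0)
      linarith
    refine le_trans ?_ h2
    have := norm_integral_le_of_forall_norm_le (μ := μ) (f := fun g => ‖F f₁ f₂ f₃ g‖) (C := 2)
      (by simpa using h1)
    exact (le_abs_self _).trans this
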